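/- Let $X$ be a finite set, let $\Omega = X^{\infty}$ be the space of infinite sequences $x_1,x_2,\dots$ over $X$ with the $\sigma$-algebra $\mathcal B$ generated by the cylinders $[x_{1..n}]$ (the set of sequences that start with $x_{1..n}$), and let $\mathcal P$ be the set of probability measures on $(\Omega,\mathcal B)$ (process measures). For $\mu,\rho\in\mathcal P$ put $v(\mu,\rho,x_{1..n})=\sup_{A\in\mathcal B}|\mu(A\mid x_{1..n})-\rho(A\mid x_{1..n})|$ if $\mu([x_{1..n}])\neq 0$ and $\rho([x_{1..n}])\ne 0$, and $v(\mu,\rho,x_{1..n})=1$ otherwise. Say that $\rho$ predicts $\mu$ if $v(\mu,\rho,x_{1..n})\to 0$ as $n\to\infty$ $\mu$-a.s., and let $$l_{tv}(\mu,\rho)=\inf\Bigl\{\alpha\in[0,1]:\limsup_{n\to\infty}v(\mu,\rho,x_{1..n})\le\alpha\ \ \mu\text{-a.s.}\Bigr\}.$$ Write $\rho\ge_{tv}\mu$ ($\rho$ dominates $\mu$) if $\mu$ is absolutely continuous with respect to $\rho$. Call $\sigma_1,\sigma_2\in\mathcal P$ disjoint if no $\nu\in\mathcal P$ satisfies both $\sigma_1\ge_{tv}\nu$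 and $\sigma_2\ge_{tv}\nu$, and call a subset of $\mathcal P$ disjoint if any two distinct elements of it are disjoint. The total variation distance on $\mathcal P$ is $v(\mu,\rho)=\sup_{A\in\mathcal B}|\mu(A)-\rho(A)|$. For a set $\mathcal C\subseteq\mathcal P$, a measure $\rho\in\mathcal P$ is a solution to - Problem 1 if $\rho$ predicts every $\mu\in\mathcal C$; - Problem 2 if $\rho$ predicts every $\nu\in\mathcal P$ that is predicted by some $\mu\in\mathcal C$; - Problem 3 if $l_{tv}(\nu,\rho)\le l_{tv}(\nu,\mu)$ for every $\nu\in\mathcal P$ and every $\mu\in\mathcal C$. Theorem. Let $\mathcal C\subseteq\mathcal P$ be non-empty. The following statements are equivalent. (i) There is a solution to Problem 1. (ii) There is a solution to Problem 2. (iii) There is a solution to Problem 3. (iv) $\mathcal C$ has an upper bound with respect to $\ge_{tv}$: some $\rho\in\mathcal P$ satisfies $\rho\ge_{tv}\mu$ for every $\mu\in\mathcal C$. (v) There is a sequence $\mu_k\in\mathcal C$, $k\in\mathbb N$, such that for some (equivalently, for every) sequence of weights $w_k\in(0,1]$, $k\in\mathbb N$, with $\sum_k w_k=1$, the measure $\nu=\sum_k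 w_k\mu_k$ satisfies $\nu\ge_{tv}\mu$ for every $\mu\in\mathcal C$. (vi) $\mathcal C$ is separable with respect to the total variation distance. (vii) Every disjoint subset of $\mathcal C^+:=\{\mu\in\mathcal P:\exists\rho\in\mathcal C,\ \rho\ge_{tv}\mu\}$ is at most countable. Moreover, every solution to any one of Problems 1, 2, 3 is a solution to the other two, and every upper bound for $\mathcal C$ is a solution to all three. The sequence $(\mu_k)$ in (v) can be taken to be any enumeration (repetitions allowed) of any countable subset of $\mathcal C$ that is dense in $\mathcal C$ in total variation distance; it can also be taken to be any enumeration (repetitions allowed) of any countable maximal disjoint subset of $\mathcal C^+$ in which every measure that is not in $\mathcal C$ is replaced by any measure from $\mathcal C$ that dominates it. -/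

import Mathlib

open MeasureTheory ProbabilityTheory Filter Set
open scoped Topology ENNReal

namespace SeqPred

/-- Process measures over the alphabet `X`: probability measures on the space of one-way infinite
sequences, with the product sigma-algebra (the one generated by the cylinders). -/
abbrev ProcessMeasure (X : Type*) [MeasurableSpace X] := ProbabilityMeasure (ℕ → X)

section

variable {X : Type*} [MeasurableSpace X]

/-- `Dominates ρ μ`: the measure `μ` is absolutely continuous with respect to `ρ`. -/
def Dominates (ρ μ : ProcessMeasure X) : Prop :=
  (μ : Measure (ℕ → X)) ≪ (ρ : Measure (ℕ → X))

open Classical in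
/-- Conditional total variation distance `v(μ, ρ, x_1, …, x_n)`: the supremum over measurable `A`
of `|μ(A | x_1, …, x_n) - ρ(A | x_1, …, x_n)|` if both measures give the cylinder of the first `n`
symbols of `x` positive probability, and `1` otherwise.
Here `PiNat.cylinder x n` is the set of all `y` with `y i = x i` for all `i < n`. -/
noncomputable def condTV (μ ρ : ProcessMeasure X) (x : ℕ → X) (n : ℕ) : ℝ :=
  if (μ : Measure (ℕ → X)) (PiNat.cylinder x n) ≠ 0 ∧
      (ρ : Measure (ℕ → X)) (PiNat.cylinder x n) ≠ 0 then
    ⨆ A : {A : Set (ℕ → X) // MeasurableSet A},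
      |((μ : Measure (ℕ → X))[|PiNat.cylinder x n]).real A.1 -
        ((ρ : Measure (ℕ → X))[|PiNat.cylinder x n]).real A.1|
  else 1

/-- `ρ` predicts `μ` in total variation. -/
def PredictsTV (ρ μ : ProcessMeasure X) : Prop :=
  ∀ᵐ x ∂(μ : Measure (ℕ → X)), Tendsto (fun n => condTV μ ρ x n) atTop (𝓝 0)

/-- Almost sure total variation loss of `ρ` with respect to `μ`. -/
noncomputable def lossTV (μ ρ : ProcessMeasure X) : ℝ :=
  sInf {α : ℝ | α ∈ Icc (0 : ℝ) 1 ∧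
    ∀ᵐ x ∂(μ : Measure (ℕ → X)), limsup (fun n => condTV μ ρ x n) atTop ≤ α}

/-- `ρ` solves the realizable problem: it predicts every element of `C`. -/
def SolvesProblem1 (C : Set (ProcessMeasure X)) (ρ : ProcessMeasure X) : Prop :=
  ∀ μ ∈ C, PredictsTV ρ μ

/-- `ρ` solves the non-realizable problem: it predicts every process measure that is predicted by
some element of `C`. -/
def SolvesProblem2 (C : Set (ProcessMeasure X)) (ρ : ProcessMeasure X) : Prop :=
  ∀ ν : ProcessMeasure X, (∃ μ ∈ C, PredictsTV μ ν) → PredictsTV ρ ν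

/-- `ρ` solves the fully agnostic problem: on every process measure its loss is at most the loss of
every element of `C`. -/
def SolvesProblem3 (C : Set (ProcessMeasure X)) (ρ : ProcessMeasure X) : Prop :=
  ∀ ν : ProcessMeasure X, ∀ μ ∈ C, lossTV ν ρ ≤ lossTV ν μ

/-- `ρ` is an upper bound of `C` with respect to absolute continuity. -/
def IsUpperBound (C : Set (ProcessMeasure X)) (ρ : ProcessMeasure X) : Prop :=
  ∀ μ ∈ C, Dominates ρ μ

/-- Positive weights, at most one, that sum to one. -/
def IsWeights (w : ℕ → ℝ) : Prop :=
  (∀ k, 0 < w k ∧ w k ≤ 1) ∧ HasSum w 1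

/-- The mixture `∑ k, w k • μ k`. -/
noncomputable def mixture (w : ℕ → ℝ) (μ : ℕ → ProcessMeasure X) : Measure (ℕ → X) :=
  Measure.sum fun k => ENNReal.ofReal (w k) • (μ k : Measure (ℕ → X))

/-- The mixture `∑ k, w k • μ k` dominates every element of `C`. -/
def MixtureDominates (C : Set (ProcessMeasure X)) (w : ℕ → ℝ) (μ : ℕ → ProcessMeasure X) : Prop :=
  ∀ ν ∈ C, (ν : Measure (ℕ → X)) ≪ mixture w μ

/-- Unconditional total variation distance. -/
noncomputable def tvDist (μ ρ : ProcessMeasure X) : ℝ :=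
  ⨆ A : {A : Set (ℕ → X) // MeasurableSet A},
    |(μ : Measure (ℕ → X)).real A.1 - (ρ : Measure (ℕ → X)).real A.1|

/-- `D` is a subset of `C` that is dense in `C` in total variation distance. -/
def IsTVDense (C D : Set (ProcessMeasure X)) : Prop :=
  D ⊆ C ∧ ∀ μ ∈ C, ∀ ε : ℝ, 0 < ε → ∃ ρ ∈ D, tvDist μ ρ < ε

/-- `C` is separable in total variation distance: it has a countable dense subset. -/
def TVSeparable (C : Set (ProcessMeasure X)) : Prop :=
  ∃ D : Set (ProcessMeasure X), D.Countable ∧ IsTVDense C D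

/-- Disjointness with respect to absolute continuity: no process measure is absolutely continuous
with respect to both. -/
def TVDisjoint (σ₁ σ₂ : ProcessMeasure X) : Prop :=
  ¬ ∃ ν : ProcessMeasure X, Dominates σ₁ ν ∧ Dominates σ₂ ν

/-- The set `C⁺` of all process measures dominated by some element of `C`. -/
def downClosure (C : Set (ProcessMeasure X)) : Set (ProcessMeasure X) :=
  {μ | ∃ ρ ∈ C, Dominates ρ μ}

/-- `S` is a disjoint subset of `C⁺`: distinct elements of `S` are disjoint. -/
def IsDisjointSubset (C S : Set (ProcessMeasure X)) : Prop :=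
  S ⊆ downClosure C ∧ S.Pairwise TVDisjoint

end

end SeqPred

open SeqPred

/-!
Everything rests on one fact: for process measures over a finite alphabet, `ρ` predicts `μ` if and
only if `μ ≪ ρ`, and `lossTV μ ρ` is `0` if `μ ≪ ρ` and `1` otherwise. Hence each of the three
problems is solved by exactly the upper bounds of `C` for absolute continuity.

That domination implies prediction is the Blackwell–Dubins theorem (`Dominates.predictsTV`). If `f`
is the density of `μ` with respect to `ρ` and `fₙ` its conditional expectation given the first `n`
symbols, then `condTV_le` bounds the conditional total variation distance, for `m ≤ n`, by
`(E[|f - fₘ| | first n symbols] + |fₘ - fₙ|) / fₙ`. By Lévy's upward theorem this tends to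
`2 |f - fₘ| / f` as `n → ∞`, and then to `0` as `m → ∞`. Conversely, if `ρ W = 0 < μ W`, then Lévy's
zero-one law makes `μ(W | first n symbols)` tend to `1` for `μ`-almost every point of `W`, while the
corresponding probability under `ρ` is `0` or undefined; so the distance tends to `1` there
(`ae_mem_tendsto_condTV_one`).

The remaining conditions concern absolute continuity alone. A mixture has the common null sets of
its components as null sets, whatever the weights (`mixtureDominates_iff`). An upper bound `ρ` embeds
`C` by densities into the separable space `L¹(ρ)` (`tvSeparable_of_isUpperBound`), and a set that is
null for a dense family is null for all of `C` (`mixtureDominates_of_isTVDense`). An upper bound also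
makes the elements of a disjoint family live on essentially disjoint sets of positive measure, of
which there are countably many (`countable_of_isDisjointSubset`). Conversely, an element of `C` that
charges a null set of a maximal disjoint family could be conditioned on that set to enlarge the
family, so the mixture over dominating elements of `C` dominates `C`
(`mixtureDominates_of_maximal`).
-/

namespace SeqPred

/-! ### Conditional expectation given a prefix -/

section Prefix

variable {X : Type*} [MeasurableSpace X]

/-- The filtration of `ℕ → X` whose `n`-th member is generated by the first `n` symbols. It is
indexed to match `PiNat.cylinder x n`, so that its `0`-th member is trivial. -/
def prefixFiltration (X : Type*) [MeasurableSpace X] :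
    Filtration ℕ (inferInstance : MeasurableSpace (ℕ → X)) where
  seq n := MeasurableSpace.comap (fun (x : ℕ → X) (i : Fin n) => x i) inferInstance
  mono' m n h := by
    have : (fun (x : ℕ → X) (i : Fin m) => x i) =
        (fun (y : Fin n → X) (i : Fin m) => y (Fin.castLE h i)) ∘
          fun (x : ℕ → X) (i : Fin n) => x i := rfl
    change MeasurableSpace.comap _ _ ≤ MeasurableSpace.comap _ _
    rw [this, ← MeasurableSpace.comap_comp]
    exact MeasurableSpace.comap_mono (Measurable.comap_le (by fun_prop))
  le' n := Measurable.comap_le (by fun_prop)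

lemma iSup_prefixFiltration :
    (⨆ n, prefixFiltration X n) = (inferInstance : MeasurableSpace (ℕ → X)) := by
  refine le_antisymm (iSup_le fun n => (prefixFiltration X).le n) ?_
  refine iSup_le fun i => le_trans ?_ (le_iSup _ (i + 1))
  change MeasurableSpace.comap _ _ ≤ MeasurableSpace.comap _ _
  have : (fun x : ℕ → X => x i) =
      (fun y : Fin (i + 1) → X => y (Fin.last i)) ∘
        fun (x : ℕ → X) (j : Fin (i + 1)) => x j := rfl
  rw [this, ← MeasurableSpace.comap_comp]
  exact MeasurableSpace.comap_mono (Measurable.comap_le (by fun_prop))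

omit [MeasurableSpace X] in
lemma cylinder_eq_preimage (x : ℕ → X) (n : ℕ) :
    PiNat.cylinder x n =
      (fun (y : ℕ → X) (i : Fin n) => y i) ⁻¹' {fun i : Fin n => x i} := by
  ext y
  simp only [PiNat.mem_cylinder_iff, mem_preimage, mem_singleton_iff, funext_iff]
  exact ⟨fun h i => h i i.2, fun h i hi => h ⟨i, hi⟩⟩

lemma measurableSet_prefixFiltration_cylinder [MeasurableSingletonClass X] (x : ℕ → X) (n : ℕ) :
    MeasurableSet[prefixFiltration X n] (PiNat.cylinder x n) :=
  ⟨_, MeasurableSet.singleton _, (cylinder_eq_preimage x n).symm⟩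

lemma measurableSet_cylinder [MeasurableSingletonClass X] (x : ℕ → X) (n : ℕ) :
    MeasurableSet (PiNat.cylinder x n) :=
  (prefixFiltration X).le n _ (measurableSet_prefixFiltration_cylinder x n)

lemma condExp_prefixFiltration_eq_of_mem_cylinder (μ : Measure (ℕ → X)) (f : (ℕ → X) → ℝ)
    {m n : ℕ} (hmn : m ≤ n) {x y : ℕ → X} (hy : y ∈ PiNat.cylinder x n) :
    (μ[f | prefixFiltration X m]) y = (μ[f | prefixFiltration X m]) x := by
  have h : Measurable[prefixFiltration X m] (μ[f | prefixFiltration X m]) :=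
    stronglyMeasurable_condExp.measurable
  refine Measurable.factorsThrough h ?_
  funext i
  exact hy i (i.2.trans_le hmn)

/-- On the atom `PiNat.cylinder x n` the conditional expectation is the constant whose integral is
right. This holds at every `x`, as the chosen version is measurable for the prefixes. -/
lemma condExp_prefixFiltration_mul_cylinder [MeasurableSingletonClass X]
    (μ : Measure (ℕ → X)) [IsFiniteMeasure μ] {f : (ℕ → X) → ℝ} (hf : Integrable f μ)
    (n : ℕ) (x : ℕ → X) :
    (μ[f | prefixFiltration X n]) x * μ.real (PiNat.cylinder x n) =
      ∫ y in PiNat.cylinder x n, f y ∂μ := by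
  rw [← setIntegral_condExp ((prefixFiltration X).le n) hf
    (measurableSet_prefixFiltration_cylinder x n),
    setIntegral_congr_fun (measurableSet_cylinder x n) fun y hy =>
      condExp_prefixFiltration_eq_of_mem_cylinder μ f le_rfl hy,
    setIntegral_const, smul_eq_mul, mul_comm]

lemma tendsto_ae_condExp_prefixFiltration (μ : Measure (ℕ → X)) [IsFiniteMeasure μ]
    {f : (ℕ → X) → ℝ} (hf : StronglyMeasurable f) (hfi : Integrable f μ) :
    ∀ᵐ x ∂μ, Tendsto (fun n => (μ[f | prefixFiltration X n]) x) atTop (𝓝 (f x)) := by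
  have h := tendsto_ae_condExp (μ := μ) (ℱ := prefixFiltration X) f
  rw [iSup_prefixFiltration, condExp_of_stronglyMeasurable le_rfl hf hfi] at h
  exact h

/-- Each of the countably many null cylinders is avoided almost surely. -/
lemma ae_cylinder_ne_zero [Finite X] [MeasurableSingletonClass X] (μ : Measure (ℕ → X)) :
    ∀ᵐ x ∂μ, ∀ n, μ (PiNat.cylinder x n) ≠ 0 := by
  rw [ae_all_iff]
  intro n
  simp_rw [cylinder_eq_preimage]
  set π : (ℕ → X) → (Fin n → X) := fun x i => x i
  have hsub : {x | ¬ μ (π ⁻¹' {π x}) ≠ 0} ⊆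
      ⋃ a ∈ {a : Fin n → X | μ (π ⁻¹' {a}) = 0}, π ⁻¹' {a} := by
    intro x hx
    simp only [mem_iUnion]
    exact ⟨π x, not_not.1 hx, rfl⟩
  exact measure_mono_null hsub ((measure_biUnion_null_iff (to_countable _)).2 fun a ha => ha)

end Prefix

/-! ### Prediction is absolute continuity -/

section CondTV

variable {X : Type*} [MeasurableSpace X]

lemma cond_real_apply [MeasurableSingletonClass X] (μ : Measure (ℕ → X)) (x : ℕ → X) (n : ℕ)
    (A : Set (ℕ → X)) :
    (μ[|PiNat.cylinder x n]).real A =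
      μ.real (PiNat.cylinder x n ∩ A) / μ.real (PiNat.cylinder x n) := by
  rw [measureReal_def, cond_apply (measurableSet_cylinder x n), ENNReal.toReal_mul,
    ENNReal.toReal_inv, div_eq_inv_mul]
  rfl

lemma abs_sub_measureReal_le_one {Ω : Type*} [MeasurableSpace Ω] (μ ρ : Measure Ω)
    [IsZeroOrProbabilityMeasure μ] [IsZeroOrProbabilityMeasure ρ] (A : Set Ω) :
    |μ.real A - ρ.real A| ≤ 1 := by
  have h1 : μ.real A ≤ 1 := measureReal_le_one
  have h2 : ρ.real A ≤ 1 := measureReal_le_one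
  have h3 : 0 ≤ μ.real A := measureReal_nonneg
  have h4 : 0 ≤ ρ.real A := measureReal_nonneg
  rw [abs_le]; constructor <;> linarith

lemma bddAbove_abs_sub_measureReal {Ω : Type*} [MeasurableSpace Ω] (μ ρ : Measure Ω)
    [IsZeroOrProbabilityMeasure μ] [IsZeroOrProbabilityMeasure ρ] :
    BddAbove (range fun A : {A : Set Ω // MeasurableSet A} => |μ.real A.1 - ρ.real A.1|) :=
  ⟨1, by rintro _ ⟨A, rfl⟩; exact abs_sub_measureReal_le_one μ ρ A⟩

lemma condTV_nonneg (μ ρ : ProcessMeasure X) (x : ℕ → X) (n : ℕ) : 0 ≤ condTV μ ρ x n := by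
  unfold condTV
  split_ifs
  · exact Real.iSup_nonneg fun _ => abs_nonneg _
  · exact zero_le_one

lemma condTV_le_one (μ ρ : ProcessMeasure X) (x : ℕ → X) (n : ℕ) : condTV μ ρ x n ≤ 1 := by
  unfold condTV
  split_ifs
  · exact Real.iSup_le (fun _ => abs_sub_measureReal_le_one _ _ _) zero_le_one
  · exact le_rfl

variable [Finite X] [DiscreteMeasurableSpace X]

/-- If `ρ` gives `W` measure zero, then it disagrees with `μ` about `W` by at least the conditional
probability of `W` under `μ`. -/
lemma condExp_indicator_le_condTV {μ ρ : ProcessMeasure X} {W : Set (ℕ → X)}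
    (hW : MeasurableSet W) (hρ : (ρ : Measure (ℕ → X)) W = 0) {x : ℕ → X} {n : ℕ}
    (hx : (μ : Measure (ℕ → X)) (PiNat.cylinder x n) ≠ 0) :
    ((μ : Measure (ℕ → X))[W.indicator 1 | prefixFiltration X n]) x ≤ condTV μ ρ x n := by
  set M : Measure (ℕ → X) := (μ : Measure (ℕ → X))
  have hpos : 0 < M.real (PiNat.cylinder x n) := ENNReal.toReal_pos hx (measure_ne_top _ _)
  have key : (M[W.indicator 1 | prefixFiltration X n]) x =
      (M[|PiNat.cylinder x n]).real W := by
    have h := condExp_prefixFiltration_mul_cylinder M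
      (f := W.indicator 1) ((integrable_const (1 : ℝ)).indicator hW) n x
    rw [cond_real_apply, eq_div_iff hpos.ne', h, setIntegral_indicator hW]
    simp
  rw [key]
  unfold condTV
  split_ifs with hc
  · have h0 : ((ρ : Measure (ℕ → X))[|PiNat.cylinder x n]).real W = 0 := by
      rw [measureReal_def, cond_absolutelyContinuous hρ, ENNReal.toReal_zero]
    refine le_trans ?_ (le_ciSup (bddAbove_abs_sub_measureReal _ _) ⟨W, hW⟩)
    rw [h0, sub_zero]
    exact le_abs_self _
  · exact measureReal_le_one

/-- With `f` the density of `μ` with respect to `ρ` and `fₙ` its conditional expectation given the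
first `n` symbols, the conditional law of `μ` has density `f / fₙ` with respect to that of `ρ`.
Comparing `f` with a fixed `fₘ`, rather than with `fₙ`, leaves only quantities whose limits in `n`
are given by Lévy's theorem. -/
lemma condTV_le {μ ρ : ProcessMeasure X} (h : Dominates ρ μ) {f : (ℕ → X) → ℝ}
    (hf : f = fun x => ((μ : Measure (ℕ → X)).rnDeriv (ρ : Measure (ℕ → X)) x).toReal)
    {m n : ℕ} (hmn : m ≤ n) {x : ℕ → X}
    (hμ : (μ : Measure (ℕ → X)) (PiNat.cylinder x n) ≠ 0) :
    condTV μ ρ x n ≤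
      (((ρ : Measure (ℕ → X))[fun y =>
          |f y - ((ρ : Measure (ℕ → X))[f | prefixFiltration X m]) y| |
          prefixFiltration X n]) x +
        |((ρ : Measure (ℕ → X))[f | prefixFiltration X m]) x -
          ((ρ : Measure (ℕ → X))[f | prefixFiltration X n]) x|) /
      ((ρ : Measure (ℕ → X))[f | prefixFiltration X n]) x := by
  have hρ : (ρ : Measure (ℕ → X)) (PiNat.cylinder x n) ≠ 0 := fun h0 => hμ (h h0)
  set M : Measure (ℕ → X) := (μ : Measure (ℕ → X))
  set P : Measure (ℕ → X) := (ρ : Measure (ℕ → X))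
  have habs : M ≪ P := h
  set K := PiNat.cylinder x n with hK
  have hKm : MeasurableSet K := measurableSet_cylinder x n
  have hfi : Integrable f P := hf ▸ Measure.integrable_toReal_rnDeriv
  have hMf : ∀ A : Set (ℕ → X), M.real A = ∫ y in A, f y ∂P := fun A => by
    rw [hf, Measure.setIntegral_toReal_rnDeriv habs]
  set p := (P[f | prefixFiltration X n]) x with hp
  set q := (P[f | prefixFiltration X m]) x with hq
  have hc : 0 < P.real K := ENNReal.toReal_pos hρ (measure_ne_top _ _)
  have hMK : 0 < M.real K := ENNReal.toReal_pos hμ (measure_ne_top _ _)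
  have hpc : p * P.real K = M.real K := by
    rw [hMf]; exact condExp_prefixFiltration_mul_cylinder P hfi n x
  have hp0 : 0 < p := by
    by_contra hneg
    exact absurd (mul_nonpos_of_nonpos_of_nonneg (not_lt.1 hneg) hc.le) (by rw [hpc]; linarith)
  have hgi : Integrable (fun y => |f y - (P[f | prefixFiltration X m]) y|) P :=
    (hfi.sub integrable_condExp).abs
  have hg := condExp_prefixFiltration_mul_cylinder P hgi n x
  set e := (P[fun y => |f y - (P[f | prefixFiltration X m]) y| | prefixFiltration X n]) x
  have hfp : ∫ y in K, |f y - p| ∂P ≤ (e + |q - p|) * P.real K := by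
    have h1 : ∫ y in K, |f y - p| ∂P ≤
        ∫ y in K, (|f y - (P[f | prefixFiltration X m]) y| + |q - p|) ∂P := by
      refine setIntegral_mono_on (hfi.sub (integrable_const p)).abs.integrableOn
        (hgi.add (integrable_const _)).integrableOn hKm fun y hy => ?_
      rw [condExp_prefixFiltration_eq_of_mem_cylinder P f hmn hy]
      exact abs_sub_le _ _ _
    rw [integral_add hgi.integrableOn (integrable_const _).integrableOn, ← hg,
      setIntegral_const, smul_eq_mul] at h1
    linarith
  rw [condTV, if_pos ⟨hμ, hρ⟩]
  have he : 0 ≤ (e + |q - p|) / p := by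
    have h0 : 0 ≤ (e + |q - p|) * P.real K :=
      (integral_nonneg fun y => abs_nonneg (f y - p)).trans hfp
    exact div_nonneg (nonneg_of_mul_nonneg_left h0 hc) hp0.le
  refine Real.iSup_le (fun A => ?_) he
  rw [cond_real_apply, cond_real_apply, ← hK, ← hpc]
  have hint : ∫ y in K ∩ A.1, (f y - p) ∂P = M.real (K ∩ A.1) - p * P.real (K ∩ A.1) := by
    rw [integral_sub hfi.integrableOn (integrable_const _).integrableOn, ← hMf,
      setIntegral_const, smul_eq_mul, mul_comm p]
  have hbound : |M.real (K ∩ A.1) - p * P.real (K ∩ A.1)| ≤ (e + |q - p|) * P.real K := by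
    rw [← hint]
    refine abs_integral_le_integral_abs.trans (le_trans ?_ hfp)
    exact setIntegral_mono_set (hfi.sub (integrable_const p)).abs.integrableOn
      (ae_of_all _ fun y => abs_nonneg _) inter_subset_left.eventuallyLE
  have hrw : M.real (K ∩ A.1) / (p * P.real K) - P.real (K ∩ A.1) / P.real K =
      (M.real (K ∩ A.1) - p * P.real (K ∩ A.1)) / (p * P.real K) := by
    field_simp
  change |M.real (K ∩ A.1) / (p * P.real K) - P.real (K ∩ A.1) / P.real K| ≤ _
  rw [hrw, abs_div, abs_of_pos (mul_pos hp0 hc), div_le_div_iff₀ (mul_pos hp0 hc) hp0]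
  calc _ ≤ (e + |q - p|) * P.real K * p := by gcongr
    _ = _ := by ring

/-- The Blackwell–Dubins theorem: a dominating measure predicts. -/
theorem Dominates.predictsTV {μ ρ : ProcessMeasure X} (h : Dominates ρ μ) : PredictsTV ρ μ := by
  set M : Measure (ℕ → X) := (μ : Measure (ℕ → X)) with hM
  set P : Measure (ℕ → X) := (ρ : Measure (ℕ → X)) with hP
  have habs : M ≪ P := h
  obtain ⟨f, hf⟩ : ∃ f : (ℕ → X) → ℝ, f = fun x => (M.rnDeriv P x).toReal := ⟨_, rfl⟩
  have hfm : StronglyMeasurable f := by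
    rw [hf]; exact (Measure.measurable_rnDeriv M P).ennreal_toReal.stronglyMeasurable
  have hfi : Integrable f P := hf ▸ Measure.integrable_toReal_rnDeriv
  have hlim := tendsto_ae_condExp_prefixFiltration P hfm hfi
  have hlim' : ∀ᵐ x ∂P, ∀ m, Tendsto
      (fun n => (P[fun y => |f y - (P[f | prefixFiltration X m]) y| | prefixFiltration X n]) x)
      atTop (𝓝 |f x - (P[f | prefixFiltration X m]) x|) := by
    rw [ae_all_iff]
    intro m
    refine tendsto_ae_condExp_prefixFiltration P ?_ (hfi.sub integrable_condExp).abs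
    exact (hfm.sub (stronglyMeasurable_condExp.mono ((prefixFiltration X).le m))).norm
  filter_upwards [habs.ae_le hlim, habs.ae_le hlim', ae_cylinder_ne_zero M,
    Measure.rnDeriv_pos habs, habs.ae_le (Measure.rnDeriv_lt_top M P)]
    with x hx hx' hcyl hpos htop
  have hfx : 0 < f x := by rw [hf]; exact ENNReal.toReal_pos hpos.ne' htop.ne
  -- for every `m` the bound of `condTV_le` tends to `2 |f x - fₘ x| / f x` as `n → ∞`
  have hbnd : ∀ m, Tendsto (fun n =>
      ((P[fun y => |f y - (P[f | prefixFiltration X m]) y| | prefixFiltration X n]) x +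
        |(P[f | prefixFiltration X m]) x - (P[f | prefixFiltration X n]) x|) /
      (P[f | prefixFiltration X n]) x) atTop
      (𝓝 ((|f x - (P[f | prefixFiltration X m]) x| +
        |(P[f | prefixFiltration X m]) x - f x|) / f x)) := fun m =>
    ((hx' m).add (tendsto_const_nhds.sub hx).abs).div hx hfx.ne'
  have hzero : Tendsto (fun m => (|f x - (P[f | prefixFiltration X m]) x| +
        |(P[f | prefixFiltration X m]) x - f x|) / f x) atTop (𝓝 0) := by
    have := (((tendsto_const_nhds (x := f x)).sub hx).abs.add
      (hx.sub (tendsto_const_nhds (x := f x))).abs).div_const (f x)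
    simpa using this
  rw [Metric.tendsto_atTop']
  intro ε hε
  obtain ⟨m, hm⟩ := (hzero.eventually_lt_const hε).exists
  obtain ⟨N, hN⟩ := eventually_atTop.1 ((hbnd m).eventually_lt_const hm)
  refine ⟨max N m, fun n hn => ?_⟩
  rw [Real.dist_eq, sub_zero, abs_of_nonneg (condTV_nonneg _ _ _ _)]
  exact (condTV_le h hf ((le_max_right _ _).trans hn.le) (hcyl n)).trans_lt
    (hN n ((le_max_left _ _).trans hn.le))

/-- Where a `ρ`-null set charged by `μ` occurs, `μ` becomes certain of it and `ρ` never considers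
it. -/
lemma ae_mem_tendsto_condTV_one {μ ρ : ProcessMeasure X} {W : Set (ℕ → X)}
    (hW : MeasurableSet W) (hρ : (ρ : Measure (ℕ → X)) W = 0) :
    ∀ᵐ x ∂(μ : Measure (ℕ → X)), x ∈ W → Tendsto (fun n => condTV μ ρ x n) atTop (𝓝 1) := by
  filter_upwards [ae_cylinder_ne_zero (μ : Measure (ℕ → X)),
    tendsto_ae_condExp_prefixFiltration (μ : Measure (ℕ → X)) (f := W.indicator 1)
      (stronglyMeasurable_one.indicator hW) ((integrable_const (1 : ℝ)).indicator hW)]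
    with x hcyl hlim hxW
  rw [indicator_of_mem hxW, Pi.one_apply] at hlim
  exact tendsto_of_tendsto_of_tendsto_of_le_of_le hlim tendsto_const_nhds
    (fun n => condExp_indicator_le_condTV hW hρ (hcyl n)) (fun n => condTV_le_one _ _ _ _)

lemma exists_tendsto_condTV_one_of_not_dominates {μ ρ : ProcessMeasure X} (h : ¬ Dominates ρ μ)
    {p : (ℕ → X) → Prop} (hp : ∀ᵐ x ∂(μ : Measure (ℕ → X)), p x) :
    ∃ x, p x ∧ Tendsto (fun n => condTV μ ρ x n) atTop (𝓝 1) := by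
  obtain ⟨W, hW, hρ, hμ⟩ : ∃ W, MeasurableSet W ∧ (ρ : Measure (ℕ → X)) W = 0 ∧
      (μ : Measure (ℕ → X)) W ≠ 0 := by
    by_contra! hcon
    exact h (Measure.AbsolutelyContinuous.mk fun W hW => hcon W hW)
  obtain ⟨x, hxW, hx⟩ := nonempty_of_measure_ne_zero <|
    (measure_inter_conull
      (t := {x | p x ∧ (x ∈ W → Tendsto (fun n => condTV μ ρ x n) atTop (𝓝 1))})
      (hp.and (ae_mem_tendsto_condTV_one hW hρ))).trans_ne hμ
  exact ⟨x, hx.1, hx.2 hxW⟩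

theorem predictsTV_iff_dominates {μ ρ : ProcessMeasure X} : PredictsTV ρ μ ↔ Dominates ρ μ := by
  refine ⟨fun h => ?_, Dominates.predictsTV⟩
  by_contra hn
  obtain ⟨x, h0, h1⟩ := exists_tendsto_condTV_one_of_not_dominates hn h
  exact zero_ne_one (tendsto_nhds_unique h0 h1)

lemma lossTV_of_dominates {μ ρ : ProcessMeasure X} (h : Dominates ρ μ) : lossTV μ ρ = 0 := by
  refine IsLeast.csInf_eq ⟨⟨⟨le_rfl, zero_le_one⟩, ?_⟩, fun α hα => hα.1.1⟩
  filter_upwards [h.predictsTV] with x hx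
  exact hx.limsup_eq.le

lemma lossTV_of_not_dominates {μ ρ : ProcessMeasure X} (h : ¬ Dominates ρ μ) :
    lossTV μ ρ = 1 := by
  refine IsLeast.csInf_eq ⟨⟨⟨zero_le_one, le_rfl⟩, ?_⟩, fun α hα => ?_⟩
  · refine ae_of_all _ fun x => limsup_le_of_le ?_ (Eventually.of_forall (condTV_le_one μ ρ x))
    exact (isBoundedUnder_of ⟨0, condTV_nonneg μ ρ x⟩ :
      IsBoundedUnder (· ≥ ·) atTop _).isCoboundedUnder_le
  · obtain ⟨x, hx, h1⟩ := exists_tendsto_condTV_one_of_not_dominates h hα.2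
    exact h1.limsup_eq ▸ hx

/-- The loss takes only the values `0` and `1`, hence losses compare as domination does. -/
lemma lossTV_le_lossTV_iff {ν μ ρ : ProcessMeasure X} :
    lossTV ν ρ ≤ lossTV ν μ ↔ (Dominates μ ν → Dominates ρ ν) := by
  by_cases hμ : Dominates μ ν <;> by_cases hρ : Dominates ρ ν <;>
    simp [hμ, hρ, lossTV_of_dominates, lossTV_of_not_dominates]

lemma solvesProblem1_iff {C : Set (ProcessMeasure X)} {ρ : ProcessMeasure X} :
    SolvesProblem1 C ρ ↔ IsUpperBound C ρ :=
  forall₂_congr fun _ _ => predictsTV_iff_dominates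

lemma solvesProblem2_iff {C : Set (ProcessMeasure X)} {ρ : ProcessMeasure X} :
    SolvesProblem2 C ρ ↔ IsUpperBound C ρ := by
  simp only [SolvesProblem2, predictsTV_iff_dominates]
  refine ⟨fun h μ hμ => h μ ⟨μ, hμ, Measure.AbsolutelyContinuous.rfl⟩, ?_⟩
  rintro h ν ⟨μ, hμ, hν⟩
  exact Measure.AbsolutelyContinuous.trans hν (h μ hμ)

lemma solvesProblem3_iff {C : Set (ProcessMeasure X)} {ρ : ProcessMeasure X} :
    SolvesProblem3 C ρ ↔ IsUpperBound C ρ := by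
  simp only [SolvesProblem3, lossTV_le_lossTV_iff]
  exact ⟨fun h μ hμ => h μ μ hμ Measure.AbsolutelyContinuous.rfl,
    fun h ν μ hμ hν => Measure.AbsolutelyContinuous.trans hν (h μ hμ)⟩

end CondTV

/-! ### Mixtures -/

section Mixture

variable {X : Type*} [MeasurableSpace X]

lemma mixture_apply_eq_zero_iff {w : ℕ → ℝ} (hw : IsWeights w) (μ : ℕ → ProcessMeasure X)
    (A : Set (ℕ → X)) :
    mixture w μ A = 0 ↔ ∀ k, (μ k : Measure (ℕ → X)) A = 0 := by
  rw [mixture, Measure.sum_apply_eq_zero]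
  refine forall_congr' fun k => ?_
  simp [(hw.1 k).1]

/-- The weights play no role in domination by a mixture: only the common null sets matter. -/
lemma mixtureDominates_iff {C : Set (ProcessMeasure X)} {w : ℕ → ℝ} (hw : IsWeights w)
    {μ : ℕ → ProcessMeasure X} :
    MixtureDominates C w μ ↔ ∀ ν ∈ C, ∀ A, MeasurableSet A →
      (∀ k, (μ k : Measure (ℕ → X)) A = 0) → (ν : Measure (ℕ → X)) A = 0 := by
  refine forall₂_congr fun ν _ => ⟨fun h A _ hA => h ((mixture_apply_eq_zero_iff hw μ A).2 hA),
    fun h => Measure.AbsolutelyContinuous.mk fun A hA h0 =>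
      h A hA ((mixture_apply_eq_zero_iff hw μ A).1 h0)⟩

lemma exists_isWeights : ∃ w, IsWeights w := by
  have h := hasSum_geometric_two' (1 : ℝ)
  have hpos : ∀ k : ℕ, (0 : ℝ) < 1 / 2 / 2 ^ k := fun k => by positivity
  exact ⟨_, fun k => ⟨hpos k, le_hasSum h k fun j _ => (hpos j).le⟩, h⟩

lemma isProbabilityMeasure_mixture {w : ℕ → ℝ} (hw : IsWeights w) (μ : ℕ → ProcessMeasure X) :
    IsProbabilityMeasure (mixture w μ) := by
  refine ⟨?_⟩
  rw [mixture, Measure.sum_apply _ MeasurableSet.univ]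
  simp only [Measure.smul_apply, measure_univ, smul_eq_mul, mul_one]
  rw [← ENNReal.ofReal_tsum_of_nonneg (fun k => (hw.1 k).1.le) hw.2.summable, hw.2.tsum_eq,
    ENNReal.ofReal_one]

lemma exists_isUpperBound_of_mixtureDominates {C : Set (ProcessMeasure X)} {w : ℕ → ℝ}
    (hw : IsWeights w) {μ : ℕ → ProcessMeasure X} (h : MixtureDominates C w μ) :
    ∃ ρ, IsUpperBound C ρ :=
  ⟨⟨mixture w μ, isProbabilityMeasure_mixture hw μ⟩, h⟩

end Mixture

/-! ### Separability in total variation -/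

section Separable

variable {X : Type*} [MeasurableSpace X]

lemma abs_sub_le_tvDist (μ ρ : ProcessMeasure X) {A : Set (ℕ → X)} (hA : MeasurableSet A) :
    |(μ : Measure (ℕ → X)).real A - (ρ : Measure (ℕ → X)).real A| ≤ tvDist μ ρ :=
  le_ciSup (f := fun A : {A : Set (ℕ → X) // MeasurableSet A} =>
    |(μ : Measure (ℕ → X)).real A.1 - (ρ : Measure (ℕ → X)).real A.1|)
    (bddAbove_abs_sub_measureReal _ _) ⟨A, hA⟩

lemma mixtureDominates_of_isTVDense {C D : Set (ProcessMeasure X)} (hD : IsTVDense C D)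
    {μ : ℕ → ProcessMeasure X} (hμ : D ⊆ range μ) {w : ℕ → ℝ} (hw : IsWeights w) :
    MixtureDominates C w μ := by
  refine (mixtureDominates_iff hw).2 fun ν hν A hA h0 => ?_
  by_contra hne
  obtain ⟨ρ, hρD, hρ⟩ := hD.2 ν hν _ (ENNReal.toReal_pos hne (measure_ne_top _ _))
  obtain ⟨k, rfl⟩ := hμ hρD
  refine absurd ((abs_sub_le_tvDist ν (μ k) hA).trans_lt hρ) ?_
  rw [measureReal_def (μ k : Measure (ℕ → X)), h0 k, ENNReal.toReal_zero, sub_zero, not_lt]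
  exact le_abs_self _

/-- The densities with respect to `ρ` embed the measures dominated by `ρ` into `L¹(ρ)`. -/
noncomputable def densityL1 (ρ μ : ProcessMeasure X) : Lp ℝ 1 (ρ : Measure (ℕ → X)) :=
  (memLp_one_iff_integrable.2 (Measure.integrable_toReal_rnDeriv
    (μ := (μ : Measure (ℕ → X))) (ν := (ρ : Measure (ℕ → X))))).toLp _

lemma tvDist_le_dist_densityL1 {ρ μ ν : ProcessMeasure X} (hμ : Dominates ρ μ)
    (hν : Dominates ρ ν) : tvDist μ ν ≤ dist (densityL1 ρ μ) (densityL1 ρ ν) := by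
  refine Real.iSup_le (fun A => ?_) dist_nonneg
  rw [← Measure.setIntegral_toReal_rnDeriv hμ, ← Measure.setIntegral_toReal_rnDeriv hν,
    ← integral_sub Measure.integrable_toReal_rnDeriv.integrableOn
      Measure.integrable_toReal_rnDeriv.integrableOn, L1.dist_eq_integral_dist]
  refine abs_integral_le_integral_abs.trans ((setIntegral_le_integral
    (Measure.integrable_toReal_rnDeriv.sub Measure.integrable_toReal_rnDeriv).abs
    (ae_of_all _ fun _ => abs_nonneg _)).trans_eq (integral_congr_ae ?_))
  filter_upwards [MemLp.coeFn_toLp (memLp_one_iff_integrable.2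
      (Measure.integrable_toReal_rnDeriv (μ := (μ : Measure (ℕ → X)))
        (ν := (ρ : Measure (ℕ → X))))),
    MemLp.coeFn_toLp (memLp_one_iff_integrable.2
      (Measure.integrable_toReal_rnDeriv (μ := (ν : Measure (ℕ → X)))
        (ν := (ρ : Measure (ℕ → X)))))] with x h1 h2
  rw [densityL1, densityL1, h1, h2, Real.dist_eq, Pi.sub_apply]

lemma tvSeparable_of_isUpperBound [Finite X] [DiscreteMeasurableSpace X]
    {C : Set (ProcessMeasure X)} {ρ : ProcessMeasure X} (h : IsUpperBound C ρ) :
    TVSeparable C := by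
  have : Fact ((1 : ℝ≥0∞) ≠ ∞) := ⟨ENNReal.one_ne_top⟩
  obtain ⟨t, htC, htc, htd⟩ := (TopologicalSpace.IsSeparable.of_separableSpace
    (densityL1 ρ '' C)).exists_countable_dense_subset
  obtain ⟨S, hSC, rfl⟩ := subset_image_iff.1 htC
  obtain ⟨D, hDS, hD⟩ := exists_subset_bijOn S (densityL1 ρ)
  rw [← hD.image_eq] at htc htd
  have hDC := hDS.trans hSC
  refine ⟨D, countable_of_injective_of_countable_image hD.injOn htc, hDC, fun μ hμ ε hε => ?_⟩
  obtain ⟨_, ⟨τ, hτ, rfl⟩, hdist⟩ := Metric.mem_closure_iff.1 (htd (mem_image_of_mem _ hμ)) ε hε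
  exact ⟨τ, hτ, (tvDist_le_dist_densityL1 (h μ hμ) (h τ (hDC hτ))).trans_lt hdist⟩

end Separable

/-! ### Disjoint families -/

section Disjoint

variable {X : Type*} [MeasurableSpace X]

/-- Conditioning on a non-null measurable set. -/
noncomputable def condOn (ρ : ProcessMeasure X) (A : Set (ℕ → X))
    (hA : (ρ : Measure (ℕ → X)) A ≠ 0) : ProcessMeasure X :=
  ⟨(ρ : Measure (ℕ → X))[|A], cond_isProbabilityMeasure hA⟩

lemma dominates_condOn (ρ : ProcessMeasure X) {A : Set (ℕ → X)}
    (hA : (ρ : Measure (ℕ → X)) A ≠ 0) : Dominates ρ (condOn ρ A hA) :=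
  cond_absolutelyContinuous

lemma condOn_compl (ρ : ProcessMeasure X) {A : Set (ℕ → X)} (hAm : MeasurableSet A)
    (hA : (ρ : Measure (ℕ → X)) A ≠ 0) : (condOn ρ A hA : Measure (ℕ → X)) Aᶜ = 0 := by
  change ((ρ : Measure (ℕ → X))[|A]) Aᶜ = 0
  rw [cond_apply hAm]; simp

lemma tvDisjoint_of_null {σ τ : ProcessMeasure X} {A : Set (ℕ → X)}
    (hσ : (σ : Measure (ℕ → X)) A = 0) (hτ : (τ : Measure (ℕ → X)) Aᶜ = 0) : TVDisjoint σ τ := by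
  rintro ⟨ν, h1, h2⟩
  have h : (ν : Measure (ℕ → X)) (A ∪ Aᶜ) = 0 := measure_union_null (h1 hσ) (h2 hτ)
  rw [union_compl_self, measure_univ] at h
  exact one_ne_zero h

lemma TVDisjoint.symm {σ τ : ProcessMeasure X} (h : TVDisjoint σ τ) : TVDisjoint τ σ :=
  fun ⟨ν, h1, h2⟩ => h ⟨ν, h2, h1⟩

/-- A part of `C` missed by the mixture would, after conditioning, extend the maximal family. -/
lemma mixtureDominates_of_maximal {C S : Set (ProcessMeasure X)}
    (hS : Maximal (IsDisjointSubset C) S) {σ μ : ℕ → ProcessMeasure X} (hσ : S ⊆ range σ)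
    (hμσ : ∀ k, Dominates (μ k) (σ k)) {w : ℕ → ℝ} (hw : IsWeights w) :
    MixtureDominates C w μ := by
  refine (mixtureDominates_iff hw).2 fun ν hν A hA h0 => ?_
  by_contra hne
  have hnull : ∀ τ ∈ S, (τ : Measure (ℕ → X)) A = 0 := by
    intro τ hτ
    obtain ⟨k, rfl⟩ := hσ hτ
    exact hμσ k (h0 k)
  have hdisj : ∀ τ ∈ S, TVDisjoint τ (condOn ν A hne) := fun τ hτ =>
    tvDisjoint_of_null (hnull τ hτ) (condOn_compl ν hA hne)
  have hins : IsDisjointSubset C (insert (condOn ν A hne) S) := by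
    refine ⟨insert_subset ⟨ν, hν, dominates_condOn ν hne⟩ hS.prop.1, ?_⟩
    exact hS.prop.2.insert fun τ hτ _ => ⟨(hdisj τ hτ).symm, hdisj τ hτ⟩
  have hmem : condOn ν A hne ∈ S := hS.le_of_ge hins (subset_insert _ _) (mem_insert _ _)
  exact hdisj _ hmem ⟨_, Measure.AbsolutelyContinuous.rfl, Measure.AbsolutelyContinuous.rfl⟩

lemma exists_maximal_isDisjointSubset (C : Set (ProcessMeasure X)) :
    ∃ S, Maximal (IsDisjointSubset C) S := by
  refine zorn_subset {S | IsDisjointSubset C S} fun c hc hchain =>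
    ⟨⋃₀ c, ⟨sUnion_subset fun S hS => (hc hS).1, ?_⟩, fun S hS => subset_sUnion_of_mem hS⟩
  exact (pairwise_sUnion hchain.directedOn).2 fun S hS => (hc hS).2

lemma nonempty_of_maximal_isDisjointSubset {C S : Set (ProcessMeasure X)} (hC : C.Nonempty)
    (hS : Maximal (IsDisjointSubset C) S) : S.Nonempty := by
  obtain ⟨ν, hν⟩ := hC
  by_contra hne
  obtain rfl := not_nonempty_iff_eq_empty.1 hne
  have hsub : {ν} ⊆ downClosure C :=
    singleton_subset_iff.2 ⟨ν, hν, Measure.AbsolutelyContinuous.rfl⟩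
  exact hS.le_of_ge ⟨hsub, pairwise_singleton _ _⟩ (empty_subset _) (mem_singleton ν)

/-- The supports of the densities of disjoint measures are almost surely disjoint sets of positive
`ρ`-measure, and a finite measure admits only countably many of these. -/
lemma countable_of_isDisjointSubset {C S : Set (ProcessMeasure X)} {ρ : ProcessMeasure X}
    (h : IsUpperBound C ρ) (hS : IsDisjointSubset C S) : S.Countable := by
  set P : Measure (ℕ → X) := (ρ : Measure (ℕ → X)) with hP
  have hdom : ∀ σ ∈ S, (σ : Measure (ℕ → X)) ≪ P := fun σ hσ => by
    obtain ⟨τ, hτ, hτσ⟩ := hS.1 hσ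
    exact Measure.AbsolutelyContinuous.trans hτσ (h τ hτ)
  let B : S → Set (ℕ → X) := fun σ => {x | (σ.1 : Measure (ℕ → X)).rnDeriv P x ≠ 0}
  have hBm : ∀ σ, MeasurableSet (B σ) := fun σ =>
    (Measure.measurable_rnDeriv _ _ (measurableSet_singleton 0)).compl
  -- on the support of its density, `σ` has the same null sets as `ρ`
  have hBσ : ∀ σ : S, ∀ E, MeasurableSet E → E ⊆ B σ → (σ.1 : Measure (ℕ → X)) E = 0 →
      P E = 0 := by
    intro σ E hE hEB h0
    rw [← Measure.setLIntegral_rnDeriv (hdom σ σ.2),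
      lintegral_eq_zero_iff (Measure.measurable_rnDeriv _ _), EventuallyEq,
      ae_restrict_iff' hE] at h0
    refine measure_mono_null (fun x hx => ?_) (ae_iff.1 h0)
    exact fun hx' => hEB hx (hx' hx)
  have hcount : {σ : S | 0 < P (B σ)}.Countable := by
    refine Measure.countable_meas_pos_of_disjoint_iUnion₀ (fun σ => (hBm σ).nullMeasurableSet) ?_
    intro σ τ hne
    by_contra hpos
    refine hS.2 σ.2 τ.2 (Subtype.coe_injective.ne hne) ⟨condOn ρ (B σ ∩ B τ) hpos, ?_, ?_⟩
    all_goals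
      refine Measure.AbsolutelyContinuous.mk fun E hE h0 => ?_
      change (P[|B σ ∩ B τ]) E = 0
      rw [cond_apply ((hBm σ).inter (hBm τ))]
    · rw [hBσ σ _ (((hBm σ).inter (hBm τ)).inter hE)
        (inter_subset_left.trans inter_subset_left) (measure_mono_null inter_subset_right h0),
        mul_zero]
    · rw [hBσ τ _ (((hBm σ).inter (hBm τ)).inter hE)
        (inter_subset_left.trans inter_subset_right) (measure_mono_null inter_subset_right h0),
        mul_zero]
  have huniv : {σ : S | 0 < P (B σ)} = univ := by
    refine eq_univ_of_forall fun σ => ?_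
    rw [mem_ofPred_eq, pos_iff_ne_zero]
    intro h0
    obtain ⟨x, hx, hx'⟩ := ((Measure.rnDeriv_pos (hdom σ σ.2)).and
      ((hdom σ σ.2).ae_le (compl_mem_ae_iff.2 h0))).exists
    exact hx' hx.ne'
  rw [huniv, countable_univ_iff] at hcount
  exact countable_coe_iff.1 hcount

end Disjoint

end SeqPred

theorem theorem1 {X : Type*} [Finite X] [MeasurableSpace X] [DiscreteMeasurableSpace X]
    (C : Set (ProcessMeasure X)) (hC : C.Nonempty) :
    -- the equivalent conditions
    List.TFAE [
      ∃ ρ, SolvesProblem1 C ρ,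
      ∃ ρ, SolvesProblem2 C ρ,
      ∃ ρ, SolvesProblem3 C ρ,
      ∃ ρ, IsUpperBound C ρ,
      ∃ μ : ℕ → ProcessMeasure X, (∀ k, μ k ∈ C) ∧
        ∃ w, IsWeights w ∧ MixtureDominates C w μ,
      ∃ μ : ℕ → ProcessMeasure X, (∀ k, μ k ∈ C) ∧
        ∀ w, IsWeights w → MixtureDominates C w μ,
      TVSeparable C,
      ∀ S, IsDisjointSubset C S → S.Countable] ∧
    -- for a given sequence, the choice of the weights does not matter
    (∀ μ : ℕ → ProcessMeasure X, (∀ k, μ k ∈ C) →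
      ((∃ w, IsWeights w ∧ MixtureDominates C w μ) ↔
        ∀ w, IsWeights w → MixtureDominates C w μ)) ∧
    -- the three problems have the same solutions, and every upper bound is one
    (∀ ρ, (SolvesProblem1 C ρ ↔ SolvesProblem2 C ρ) ∧ (SolvesProblem2 C ρ ↔ SolvesProblem3 C ρ)) ∧
    (∀ ρ, IsUpperBound C ρ → SolvesProblem1 C ρ ∧ SolvesProblem2 C ρ ∧ SolvesProblem3 C ρ) ∧
    -- the sequence can be any enumeration of a countable dense subset of `C`
    (∀ D, IsTVDense C D → ∀ μ : ℕ → ProcessMeasure X, range μ = D →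
      ∀ w, IsWeights w → MixtureDominates C w μ) ∧
    -- or of a maximal disjoint subset of `C⁺`, with the measures outside `C` replaced by
    -- measures in `C` that dominate them
    (∀ S, Maximal (IsDisjointSubset C) S →
      ∀ σ : ℕ → ProcessMeasure X, range σ = S →
      ∀ μ : ℕ → ProcessMeasure X,
        (∀ k, (σ k ∈ C → μ k = σ k) ∧ (σ k ∉ C → μ k ∈ C ∧ Dominates (μ k) (σ k))) →
      ∀ w, IsWeights w → MixtureDominates C w μ) := by
  have weights_iff : ∀ μ : ℕ → ProcessMeasure X, (∃ w, IsWeights w ∧ MixtureDominates C w μ) ↔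
      ∀ w, IsWeights w → MixtureDominates C w μ := by
    intro μ
    constructor
    · rintro ⟨w, hw, h⟩ w' hw'
      exact (mixtureDominates_iff hw').2 ((mixtureDominates_iff hw).1 h)
    · intro h
      obtain ⟨w, hw⟩ := exists_isWeights
      exact ⟨w, hw, h w hw⟩
  refine ⟨?_, fun μ _ => weights_iff μ, fun ρ => ⟨?_, ?_⟩, fun ρ h => ⟨solvesProblem1_iff.2 h,
    solvesProblem2_iff.2 h, solvesProblem3_iff.2 h⟩, ?_, ?_⟩
  · simp only [solvesProblem1_iff, solvesProblem2_iff, solvesProblem3_iff, ← weights_iff]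
    tfae_have 1 ↔ 2 := Iff.rfl
    tfae_have 2 ↔ 3 := Iff.rfl
    tfae_have 3 ↔ 4 := Iff.rfl
    tfae_have 5 ↔ 6 := Iff.rfl
    tfae_have 5 → 4 := fun ⟨_, _, _, hw, h⟩ => exists_isUpperBound_of_mixtureDominates hw h
    tfae_have 4 → 7 := fun ⟨_, h⟩ => tvSeparable_of_isUpperBound h
    tfae_have 7 → 5 := by
      rintro ⟨D, hDc, hD⟩
      obtain ⟨ν, hν⟩ := hC
      obtain ⟨ρ, hρ, -⟩ := hD.2 ν hν 1 one_pos
      obtain ⟨μ, rfl⟩ := hDc.exists_eq_range ⟨ρ, hρ⟩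
      obtain ⟨w, hw⟩ := exists_isWeights
      exact ⟨μ, fun k => hD.1 (mem_range_self k), w, hw,
        mixtureDominates_of_isTVDense hD subset_rfl hw⟩
    tfae_have 4 → 8 := fun ⟨_, h⟩ _ hS => countable_of_isDisjointSubset h hS
    tfae_have 8 → 5 := by
      intro h
      obtain ⟨S, hS⟩ := exists_maximal_isDisjointSubset C
      obtain ⟨σ, rfl⟩ := (h S hS.prop).exists_eq_range (nonempty_of_maximal_isDisjointSubset hC hS)
      choose μ hμ hμσ using fun k => hS.prop.1 (mem_range_self k)
      obtain ⟨w, hw⟩ := exists_isWeights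
      exact ⟨μ, hμ, w, hw, mixtureDominates_of_maximal hS subset_rfl hμσ hw⟩
    tfae_finish
  · rw [solvesProblem1_iff, solvesProblem2_iff]
  · rw [solvesProblem2_iff, solvesProblem3_iff]
  · rintro D hD μ rfl w hw
    exact mixtureDominates_of_isTVDense hD subset_rfl hw
  · rintro S hS σ rfl μ hμ w hw
    refine mixtureDominates_of_maximal hS subset_rfl (fun k => ?_) hw
    by_cases hk : σ k ∈ C
    · rw [(hμ k).1 hk]
      exact Measure.AbsolutelyContinuous.rfl
    · exact ((hμ k).2 hk).2
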